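/- **Conventions.** A *representation* of a set $X$ is a surjective partial map $\delta_X:\subseteq\mathbb{N}^{\mathbb{N}}\to X$; then $(X,\delta_X)$ is a *represented space* and carries the *final topology* $\mathcal{O}(X)=\{U\subseteq X:\delta_X^{-1}(U)\text{ is open in }\mathrm{dom}(\delta_X)\}$. A partial map $f:\subseteq X\to Y$ between represented spaces is *computable* (*continuous*) if there is a computable (continuous) $F:\subseteq\mathbb{N}^{\mathbb{N}}\to\mathbb{N}^{\mathbb{N}}$ with $\delta_Y(F(p))=f(\delta_X(p))$ for all $p\in\mathrm{dom}(f\circ\delta_X)$. A *computable embedding* is an injective computable map $f:X\to Y$ whose partial inverse $f^{-1}:\subseteq Y\to X$ is computable. Sierpiński space $\mathbb{S}=\{0,1\}$ is represented by $\delta_{\mathbb{S}}(p)=0\iff p=000\dots$. For $q\in\mathbb{N}^{\mathbb{N}}$ let $\eta_q:\subseteq\mathbb{N}^{\mathbb{N}}\to\mathbb{N}^{\mathbb{N}}$ be the partial continuous function with Kleene associate $q$, i.e. $\eta_q(p)(n)=m$ iff $q(\langle n,p(0),\dots,p(k-1)\rangle)=m+1$ for the least $k$ at which $q(\langle n,p(0),\dots,p(k-1)\rangle)\neq0$;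 a partial function on $\mathbb{N}^{\mathbb{N}}$ is computable iff it is a restriction of some $\eta_q$ with $q$ computable. The set $\mathcal{O}(X)$ is itself represented by the function space representation of the continuous maps $X\to\mathbb{S}$: $\delta_{\mathcal{O}(X)}(q)=U$ iff $\eta_q$ realizes the characteristic function $\chi_U:X\to\mathbb{S}$. A represented space $X$ is a *computable Kolmogorov space* if $\mathcal{U}:X\to\mathcal{O}\mathcal{O}(X)$, $x\mapsto\{U\in\mathcal{O}(X):x\in U\}$, is a computable embedding. A representation $\delta_X$ is *admissible* with respect to a topology $\tau$ on $X$ if $\delta_X$ is continuous with respect to $\tau$ and every representation $\delta$ of $X$ that is continuous with respect to $\tau$ is also continuous with respect to $\delta_X$, i.e. $\delta=\delta_X\circ F$ on $\mathrm{dom}(\delta)$ for some continuous $F:\subseteq\mathbb{N}^{\mathbb{N}}\to\mathbb{N}^{\mathbb{N}}$. **Theorem (Presubbase theorem).** Let $X$ be a set, let $Y$ be a represented space and let $(B_y)_{y\in Y}$ be a *presubbase* of $X$, i.e. a family of subsets of $X$ such that the transpose $B^{\mathsf T}:X\to\mathcal{O}(Y)$, $x\mapsto\{y\in Y:x\in B_y\}$,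 is well defined (all these sets are open in $Y$) and injective. Let $\delta^B:\subseteq\mathbb{N}^{\mathbb{N}}\to X$ be the *presubbase representation*, given by $\delta^B(p)=x\iff\delta_{\mathcal{O}(Y)}(p)=\{y\in Y:x\in B_y\}$. Then $(X,\delta^B)$ is a computable Kolmogorov space. Moreover, the set $X$ and the sets $\bigcap_{y\in K}B_y$, for all compact $K\subseteq Y$ (compactness with respect to the final topology of $Y$, no Hausdorff condition), form a base of the topology $\tau$ on $X$ that they generate, and $\delta^B$ is admissible with respect to $\tau$. -/

import Mathlib

namespace CompAn

universe u v

open scoped Topology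

/-- Baire space, with the product topology of discrete spaces (Mathlib's instance on `ℕ → ℕ`). -/
abbrev Baire : Type := ℕ → ℕ

/-- A representation of `X`: a surjective partial map from Baire space to `X`. -/
structure Representation (X : Type u) where
  toPFun : Baire →. X
  surj : ∀ x : X, ∃ p : Baire, x ∈ toPFun p

/-- Code of the finite word `n, p 0, …, p (k - 1)`. -/
def prefixCode (n : ℕ) (p : Baire) (k : ℕ) : ℕ :=
  Encodable.encode (n :: (List.range k).map p)

/-- The partial function on Baire space with Kleene associate `q`: to find the `n`-th value at `p`,
feed longer and longer prefixes of `p` to `q`, until `q` answers with some `m + 1`; then the value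
is `m`. The function is defined at `p` if all values are found. -/
def eta (q : Baire) : Baire →. Baire := fun p =>
  { Dom := ∀ n, ∃ k, q (prefixCode n p k) ≠ 0
    get := fun h n => q (prefixCode n p (Nat.find (h n))) - 1 }

/-- A partial function on Baire space is computable if it has a computable associate. -/
def IsComputable (F : Baire →. Baire) : Prop :=
  ∃ a : ℕ → ℕ, Computable a ∧ ∀ p r, r ∈ F p → r ∈ eta a p

/-- `F` realizes the partial map `f` with respect to the two representations. -/
def Realizes {X : Type u} {Y : Type v} (δX : Representation X) (δY : Representation Y)
    (F : Baire →. Baire) (f : X →. Y) : Prop :=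
  ∀ p x y, x ∈ δX.toPFun p → y ∈ f x → ∃ r ∈ F p, y ∈ δY.toPFun r

/-- Computability of a partial map between represented spaces. -/
def ComputableRepMap {X : Type u} {Y : Type v} (δX : Representation X) (δY : Representation Y)
    (f : X →. Y) : Prop :=
  ∃ F : Baire →. Baire, IsComputable F ∧ Realizes δX δY F f

/-- Continuity of a partial map between represented spaces, in the sense of having a realizer that
is continuous on its domain. -/
def ContinuousRepMap {X : Type u} {Y : Type v} (δX : Representation X) (δY : Representation Y)
    (f : X →. Y) : Prop :=
  ∃ F : Baire →. Baire, Continuous F.asSubtype ∧ Realizes δX δY F f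

/-- The inverse, with domain the range of `f`, of an injective map `f`. -/
noncomputable def partialInverse {X : Type u} {Y : Type v} (f : X → Y) : Y →. X := fun y =>
  { Dom := ∃ x, f x = y
    get := fun h => h.choose }

/-- Computable embeddings of represented spaces. -/
def ComputableEmbedding {X : Type u} {Y : Type v} (δX : Representation X) (δY : Representation Y)
    (f : X → Y) : Prop :=
  Function.Injective f ∧ ComputableRepMap δX δY (f : X →. Y) ∧
    ComputableRepMap δY δX (partialInverse f)

/-- The partial map whose graph is the single-valued relation `R`. -/
noncomputable def pfunOfRel {X : Type u} (R : Baire → X → Prop) : Baire →. X := fun p =>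
  { Dom := ∃ x, R p x
    get := fun h => h.choose }

theorem mem_pfunOfRel {X : Type u} {R : Baire → X → Prop}
    (hR : ∀ p x y, R p x → R p y → x = y) (p : Baire) (x : X) :
    x ∈ pfunOfRel R p ↔ R p x := by
  constructor
  · rintro ⟨h, rfl⟩
    exact h.choose_spec
  · intro h
    exact ⟨⟨x, h⟩, hR _ _ _ (Exists.choose_spec (⟨x, h⟩ : ∃ x, R p x)) h⟩

/-- Baire space represented by the identity. -/
def baireRep : Representation Baire where
  toPFun := PFun.id Baire
  surj := fun x => ⟨x, by simp⟩

/-- Sierpiński space, with carrier `Prop`: the zero sequence is the only name of `False`, every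
other sequence is a name of `True`. -/
def sierpinskiRep : Representation Prop where
  toPFun := fun p => Part.some (∃ n, p n ≠ 0)
  surj := fun P => by
    by_cases h : P
    · exact ⟨fun _ => 1, by simp [h]⟩
    · exact ⟨fun _ => 0, by simp [h]⟩

/-- The final topology of a represented space. -/
@[reducible]
def Representation.finalTopology {X : Type u} (δ : Representation X) : TopologicalSpace X :=
  TopologicalSpace.coinduced δ.toPFun.asSubtype inferInstance

/-- The set of open subsets of a represented space. -/
def OpenSets {X : Type u} (δ : Representation X) : Type u :=
  {U : Set X // IsOpen[δ.finalTopology] U}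

/-- `q` is a name of the function `f` in the function space representation. -/
def FunctionName {X : Type u} {Y : Type v} (δX : Representation X) (δY : Representation Y)
    (q : Baire) (f : X → Y) : Prop :=
  Realizes δX δY (eta q) (f : X →. Y)

/-- `q` is a name of the open set `U`, if it is a name of its characteristic function
with values in Sierpiński space. -/
def OpenName {X : Type u} (δ : Representation X) (q : Baire) (U : OpenSets δ) : Prop :=
  FunctionName δ sierpinskiRep q (fun x => x ∈ U.1)

theorem OpenName.exists_iff {X : Type u} {δ : Representation X} {q : Baire} {U : OpenSets δ}
    (h : OpenName δ q U) {p : Baire} {x : X} (hx : x ∈ δ.toPFun p) :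
    ∃ r ∈ eta q p, (x ∈ U.1 ↔ ∃ n, r n ≠ 0) := by
  obtain ⟨r, hr, hr'⟩ := h p x (x ∈ U.1) hx (by simp)
  refine ⟨r, hr, ?_⟩
  simp only [sierpinskiRep, Part.mem_some_iff] at hr'
  exact iff_of_eq hr'

theorem OpenName.unique {X : Type u} {δ : Representation X} (q : Baire) (U V : OpenSets δ)
    (hU : OpenName δ q U) (hV : OpenName δ q V) : U = V := by
  refine Subtype.ext (Set.ext fun x => ?_)
  obtain ⟨p, hp⟩ := δ.surj x
  obtain ⟨r, hr, h1⟩ := hU.exists_iff hp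
  obtain ⟨s, hs, h2⟩ := hV.exists_iff hp
  rw [h1, h2, Part.mem_unique hr hs]

theorem OpenName.exists {X : Type u} {δ : Representation X} (U : OpenSets δ) :
    ∃ q, OpenName δ q U := by
  classical
  obtain ⟨V, hVo, hV⟩ : ∃ V : Set Baire, IsOpen V ∧
      ∀ p x, x ∈ δ.toPFun p → (x ∈ U.1 ↔ p ∈ V) := by
    obtain ⟨V, hVo, hV⟩ := isOpen_induced_iff.1 (isOpen_coinduced.1 U.2)
    refine ⟨V, hVo, fun p x hx => ?_⟩
    have hd : p ∈ δ.toPFun.Dom := Part.dom_iff_mem.2 ⟨x, hx⟩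
    have h2 : ((⟨p, hd⟩ : δ.toPFun.Dom) ∈ Subtype.val ⁻¹' V) ↔
        ((⟨p, hd⟩ : δ.toPFun.Dom) ∈ δ.toPFun.asSubtype ⁻¹' U.1) := by rw [hV]
    have h3 : δ.toPFun.asSubtype ⟨p, hd⟩ = x := Part.get_eq_of_mem hx _
    rw [Set.mem_preimage, Set.mem_preimage, h3] at h2
    exact h2.symm
  -- a word is accepted if its cylinder is contained in `V`
  let good : List ℕ → Prop := fun l => ∀ p : Baire, (List.range l.length).map p = l → p ∈ V
  let ans : List ℕ → ℕ := fun l =>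
    match l with
    | [] => 0
    | n :: l => if l.length < n then 0 else if good l then 2 else 1
  let q : Baire := fun c => ((Encodable.decode c : Option (List ℕ)).map ans).getD 0
  have hq : ∀ n p k, q (prefixCode n p k) =
      if k < n then 0 else if good ((List.range k).map p) then 2 else 1 := by
    intro n p k
    simp [q, prefixCode, ans]
  have hgood : ∀ (p : Baire) k, good ((List.range k).map p) ↔
      ∀ s : Baire, (∀ i < k, s i = p i) → s ∈ V := by
    intro p k
    simp [good]
  refine ⟨q, fun p x y hx hy => ?_⟩
  have hy' : y = (x ∈ U.1) := by simpa using hy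
  subst hy'
  have hd : ∀ n, ∃ k, q (prefixCode n p k) ≠ 0 := by
    intro n
    refine ⟨n, ?_⟩
    rw [hq]
    split_ifs <;> simp_all
  have hfind : ∀ n, Nat.find (hd n) = n := by
    intro n
    rw [Nat.find_eq_iff]
    constructor
    · rw [hq]
      split_ifs <;> simp_all
    · intro k hk
      rw [hq]
      simp [hk]
  refine ⟨_, ⟨hd, rfl⟩, ?_⟩
  simp only [sierpinskiRep, Part.mem_some_iff]
  refine propext ?_
  rw [hV p x hx]
  have hval : ∀ n, (eta q p).get hd n ≠ 0 ↔ good ((List.range n).map p) := by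
    intro n
    have : (eta q p).get hd n = q (prefixCode n p (Nat.find (hd n))) - 1 := rfl
    rw [this, hfind, hq]
    split_ifs <;> simp_all
  simp only [hval, hgood]
  constructor
  · intro hp
    have hnhds := hVo.mem_nhds hp
    rw [nhds_pi, Filter.mem_pi] at hnhds
    obtain ⟨I, hI, t, ht, hsub⟩ := hnhds
    obtain ⟨n, hn⟩ := hI.bddAbove
    refine ⟨n + 1, fun s hs => hsub ?_⟩
    intro i hi
    rw [hs i (Nat.lt_succ_of_le (hn hi))]
    exact mem_of_mem_nhds (ht i)
  · rintro ⟨n, hn⟩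
    exact hn p fun _ _ => rfl

/-- The standard representation of the set of open subsets. -/
noncomputable def openRep {X : Type u} (δ : Representation X) : Representation (OpenSets δ) where
  toPFun := pfunOfRel (OpenName δ)
  surj := fun U => by
    obtain ⟨q, hq⟩ := OpenName.exists U
    exact ⟨q, (mem_pfunOfRel OpenName.unique q U).2 hq⟩

theorem mem_openRep {X : Type u} (δ : Representation X) (q : Baire) (U : OpenSets δ) :
    U ∈ (openRep δ).toPFun q ↔ OpenName δ q U :=
  mem_pfunOfRel OpenName.unique q U

theorem mem_eta_iff (q p r : Baire) : r ∈ eta q p ↔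
    ∀ n, ∃ k, q (prefixCode n p k) = r n + 1 ∧ ∀ j < k, q (prefixCode n p j) = 0 := by
  constructor
  · rintro ⟨h, rfl⟩ n
    have h' : ∀ n, ∃ k, q (prefixCode n p k) ≠ 0 := h
    refine ⟨Nat.find (h' n), ?_, fun j hj => by simpa using Nat.find_min (h' n) hj⟩
    have hs := Nat.find_spec (h' n)
    change _ = q (prefixCode n p (Nat.find (h' n))) - 1 + 1
    omega
  · intro h
    have h' : ∀ n, ∃ k, q (prefixCode n p k) ≠ 0 := fun n => by
      obtain ⟨k, hk, -⟩ := h n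
      exact ⟨k, by omega⟩
    refine ⟨h', funext fun n => ?_⟩
    obtain ⟨k, hk, hj⟩ := h n
    have hf : Nat.find (h' n) = k := by
      rw [Nat.find_eq_iff]
      exact ⟨by omega, fun j hjk => by simpa using hj j hjk⟩
    change q (prefixCode n p (Nat.find (h' n))) - 1 = r n
    rw [hf, hk]
    rfl

/-- The open neighbourhoods of a point form an open subset of the space of open sets. -/
theorem isOpen_neighbourhoods {X : Type u} (δ : Representation X) (x : X) :
    IsOpen[(openRep δ).finalTopology] {U : OpenSets δ | x ∈ U.1} := by
  obtain ⟨p, hp⟩ := δ.surj x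
  rw [Representation.finalTopology, isOpen_coinduced, isOpen_induced_iff]
  refine ⟨⋃ n, ⋃ k, {q : Baire | 2 ≤ q (prefixCode n p k) ∧ ∀ j < k, q (prefixCode n p j) = 0},
    ?_, ?_⟩
  · refine isOpen_iUnion fun n => isOpen_iUnion fun k => ?_
    have h1 : IsOpen {q : Baire | 2 ≤ q (prefixCode n p k)} :=
      (isOpen_discrete (Set.Ici 2)).preimage (continuous_apply (prefixCode n p k))
    have h2 : IsOpen (⋂ j ∈ Set.Iio k, {q : Baire | q (prefixCode n p j) = 0}) :=
      (Set.finite_Iio k).isOpen_biInter fun j _ =>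
        (isOpen_discrete {0}).preimage (continuous_apply (prefixCode n p j))
    convert h1.inter h2 using 1
    ext q
    simp
  · ext ⟨q, hq⟩
    set U : OpenSets δ := (openRep δ).toPFun.asSubtype ⟨q, hq⟩ with hU
    have hqU : OpenName δ q U := (mem_openRep δ q U).1 ⟨hq, rfl⟩
    obtain ⟨r, hr, hiff⟩ := hqU.exists_iff hp
    rw [mem_eta_iff] at hr
    rw [Set.mem_preimage, Set.mem_preimage, ← hU, Set.mem_ofPred_eq, hiff]
    simp only [Set.mem_iUnion, Set.mem_ofPred_eq]
    refine exists_congr fun n => ?_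
    obtain ⟨k, hk, hj⟩ := hr n
    constructor
    · rintro ⟨k', hk', hj'⟩
      have : k' = k := by
        rcases lt_trichotomy k k' with h | h | h
        · have := hj' k h; omega
        · exact h.symm
        · have := hj k' h; omega
      subst this
      omega
    · intro h
      exact ⟨k, by omega, hj⟩

/-- The neighbourhood map `x ↦ {U : x ∈ U}` from a represented space to the space of open sets of
its space of open sets. -/
def neighbourhoodMap {X : Type u} (δ : Representation X) (x : X) : OpenSets (openRep δ) :=
  ⟨{U : OpenSets δ | x ∈ U.1}, isOpen_neighbourhoods δ x⟩

/-- Computable Kolmogorov spaces: the neighbourhood map is a computable embedding. -/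
def Representation.IsComputableKolmogorov {X : Type u} (δ : Representation X) : Prop :=
  ComputableEmbedding δ (openRep (openRep δ)) (neighbourhoodMap δ)

/-- A representation is continuous with respect to a topology `τ` if it is continuous as a
map on its domain, a subspace of Baire space. -/
def Representation.ContinuousWrt {X : Type u} (δ : Representation X) (τ : TopologicalSpace X) :
    Prop :=
  Continuous[inferInstance, τ] δ.toPFun.asSubtype

/-- Admissibility with respect to a topology `τ`. -/
def Representation.IsAdmissible {X : Type u} (δX : Representation X) (τ : TopologicalSpace X) :
    Prop :=
  δX.ContinuousWrt τ ∧
    ∀ δ : Representation X, δ.ContinuousWrt τ → ContinuousRepMap baireRep δX δ.toPFun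

/-- The family `B`, indexed by a represented space, is a presubbase: its transpose
`x ↦ {y : x ∈ B y}` takes open sets as values and is injective. -/
structure IsPresubbase {X : Type u} {Y : Type v} (δY : Representation Y) (B : Y → Set X) :
    Prop where
  isOpen : ∀ x : X, IsOpen[δY.finalTopology] {y : Y | x ∈ B y}
  injective : Function.Injective fun x : X => {y : Y | x ∈ B y}

/-- The transpose of a presubbase. -/
def transpose {X : Type u} {Y : Type v} {δY : Representation Y} {B : Y → Set X}
    (hB : IsPresubbase δY B) (x : X) : OpenSets δY :=
  ⟨{y : Y | x ∈ B y}, hB.isOpen x⟩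

theorem presubbase_unique {X : Type u} {Y : Type v} {δY : Representation Y} {B : Y → Set X}
    (hB : IsPresubbase δY B) (p : Baire) (x x' : X)
    (h : transpose hB x ∈ (openRep δY).toPFun p) (h' : transpose hB x' ∈ (openRep δY).toPFun p) :
    x = x' :=
  hB.injective (congrArg Subtype.val (Part.mem_unique h h'))

/-- The presubbase representation: `p` is a name of `x` if and only if `p` is a name of the open
set `{y : x ∈ B y}`. -/
noncomputable def presubbaseRep {X : Type u} {Y : Type v} {δY : Representation Y}
    {B : Y → Set X} (hB : IsPresubbase δY B) : Representation X where
  toPFun := pfunOfRel fun p x => transpose hB x ∈ (openRep δY).toPFun p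
  surj := fun x => by
    obtain ⟨p, hp⟩ := (openRep δY).surj (transpose hB x)
    exact ⟨p, (mem_pfunOfRel (presubbase_unique hB) p x).2 hp⟩

theorem mem_presubbaseRep {X : Type u} {Y : Type v} {δY : Representation Y} {B : Y → Set X}
    (hB : IsPresubbase δY B) (p : Baire) (x : X) :
    x ∈ (presubbaseRep hB).toPFun p ↔ transpose hB x ∈ (openRep δY).toPFun p :=
  mem_pfunOfRel (presubbase_unique hB) p x

/-- The whole space and the intersections of the `B y` over compact sets of indices. -/
def compactIntersections {X : Type u} {Y : Type v} (δY : Representation Y) (B : Y → Set X) :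
    Set (Set X) :=
  {Set.univ} ∪ {A | ∃ K : Set Y, @IsCompact Y δY.finalTopology K ∧ A = ⋂ y ∈ K, B y}

/-- The topology generated by `compactIntersections`. -/
@[reducible]
def compactIntersectionTopology {X : Type u} {Y : Type v} (δY : Representation Y)
    (B : Y → Set X) : TopologicalSpace X :=
  TopologicalSpace.generateFrom (compactIntersections δY B)

end CompAn

namespace CompAn

open scoped Topology

universe u v

/-! A name `p` of `x` is a name of `{y | x ∈ B y}`, so `x ∈ B y` is semidecided from finite prefixes
of names of `x` and `y`. Everything rests on this symmetry between points and indices. Kolmogorov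
property: evaluation makes `x ↦ {U | x ∈ U}` computable for any representation, and likewise `y ↦ B
y` as a map into the open sets of `X`. The sets `B y` separate points, which gives injectivity.
Pulling `{U | x ∈ U}` back along `y ↦ B y` yields `{y | x ∈ B y}`, whose names are the names of `x`;
this computes the inverse. Both maps have total realizers, because searches are replaced by tests of
bounded size (`Witness`) whose `n`-th outcome depends on `n` input values only. Topology: unions of
two compact sets are compact, so the generators are closed under intersection. If names `P n` of `ξ
n` converge to a name of `x ∈ ⋂ y ∈ K, B y`, compactness of `K` puts `ξ n` into this intersection
for large `n` (`continuousWrt_presubbaseRep`). Conversely, a convergent sequence of indices together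
with its limit is compact, so a representation continuous for the topology also determines `x ∈ B y`
from finite prefixes (`exists_prefix_of_continuousWrt`), which yields the translation. -/

/-- The sequence that starts with the word `l` and goes on with zeros. -/
def word (l : List ℕ) : Baire := fun i => l.getD i 0

theorem word_prefix (p : Baire) {k i : ℕ} (h : i < k) : word ((List.range k).map p) i = p i := by
  simp [word, h]

theorem primrec_word {α : Type*} [Primcodable α] {f : α → List ℕ} (hf : Primrec f) :
    Primrec₂ fun x m => word (f x) m :=
  (Primrec.list_getD 0).comp (hf.comp Primrec.fst) Primrec.snd

theorem prefixCode_congr {p p' : Baire} (n : ℕ) {k : ℕ} (h : ∀ i < k, p i = p' i) :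
    prefixCode n p k = prefixCode n p' k := by
  have : (List.range k).map p = (List.range k).map p' :=
    List.map_congr_left fun i hi => h i (List.mem_range.1 hi)
  rw [prefixCode, prefixCode, this]

theorem primrec_prefixCode {α : Type*} [Primcodable α] {n k : α → ℕ} {f : α → Baire}
    (hn : Primrec n) (hf : Primrec₂ fun x m => f x m) (hk : Primrec k) :
    Primrec fun x => prefixCode (n x) (f x) (k x) :=
  Primrec.encode.comp (Primrec.list_cons.comp hn (Primrec.list_map (Primrec.list_range.comp hk) hf))

/-! ### Local functionals and their associates -/

/-- A family of functionals is local if the `n`-th one only depends on the first `n` values of its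
argument. -/
def IsLocal (A : ℕ → Baire → ℕ) : Prop :=
  ∀ n p q, (∀ i < n, p i = q i) → A n p = A n q

/-- The associate of the function `p ↦ (A n p)ₙ`, for a local family `A`. It gives the `n`-th value
as soon as it has seen `n` values of the argument. -/
def localAssociate (A : ℕ → Baire → ℕ) : Baire := fun c =>
  let l := Denumerable.ofNat (List ℕ) c
  if l.length = l.headI + 1 then A l.headI (word l.tail) + 1 else 0

theorem localAssociate_prefixCode (A : ℕ → Baire → ℕ) (n : ℕ) (p : Baire) (k : ℕ) :
    localAssociate A (prefixCode n p k) =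
      if k = n then A n (word ((List.range k).map p)) + 1 else 0 := by
  have : Denumerable.ofNat (List ℕ) (prefixCode n p k) = n :: (List.range k).map p :=
    Denumerable.ofNat_encode _
  simp [localAssociate, this]

theorem mem_eta_localAssociate {A : ℕ → Baire → ℕ} (hA : IsLocal A) (p : Baire) :
    (fun n => A n p) ∈ eta (localAssociate A) p := by
  rw [mem_eta_iff]
  refine fun n => ⟨n, ?_, fun j hj => ?_⟩
  · rw [localAssociate_prefixCode, if_pos rfl, hA n _ p fun i hi => word_prefix p hi]
  · rw [localAssociate_prefixCode, if_neg hj.ne]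

/-- A word is coded by pairing its head with the code of its tail, so the head is at most the code.
This turns locality at the output index into locality at the code `c`. -/
theorem headI_ofNat_le {c : ℕ}
    (h : (Denumerable.ofNat (List ℕ) c).length = (Denumerable.ofNat (List ℕ) c).headI + 1) :
    (Denumerable.ofNat (List ℕ) c).headI ≤ c := by
  have hc : Encodable.encode (Denumerable.ofNat (List ℕ) c) = c := Denumerable.encode_ofNat c
  generalize Denumerable.ofNat (List ℕ) c = l at h hc
  cases l with
  | nil => simp at h
  | cons n u =>
    subst hc
    rw [Encodable.encode_list_cons]
    exact (Nat.left_le_pair n _).trans (Nat.le_succ _)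

/-- The associate of the partially evaluated functional depends locally on the evaluated
argument. -/
theorem isLocal_localAssociate {T : ℕ → Baire → Baire → ℕ}
    (hT : ∀ n s s' z, (∀ i < n, s i = s' i) → T n s z = T n s' z) :
    IsLocal fun c s => localAssociate (fun n => T n s) c := by
  intro c s s' h
  simp only [localAssociate]
  split_ifs with hl
  · rw [hT _ s s' _ fun i hi => h i (hi.trans_le (headI_ofNat_le hl))]
  · rfl

/-- An associate evaluates its functionals only at finite words padded with zeros, so primitive
recursiveness is required only there. -/
theorem primrec_localAssociate {α : Type*} [Primcodable α] {A : α → ℕ → Baire → ℕ}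
    (hA : Primrec fun x : α × ℕ × List ℕ => A x.1 x.2.1 (word x.2.2)) :
    Primrec₂ fun x c => localAssociate (A x) c := by
  have hl : Primrec fun x : α × ℕ => Denumerable.ofNat (List ℕ) x.2 :=
    (Primrec.ofNat (List ℕ)).comp Primrec.snd
  have hh := Primrec.list_headI.comp hl
  refine Primrec.ite (Primrec.eq.comp (Primrec.list_length.comp hl) (Primrec.succ.comp hh))
    (Primrec.succ.comp (hA.comp (Primrec.fst.pair (hh.pair (Primrec.list_tail.comp hl)))))
    (Primrec.const 0)

/-! ### Bounded witnesses for nonzero values -/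

/-- `n` witnesses that the function with associate `q` has a nonzero value at `p`. Only the first
`n` values of `q` and of `p` are inspected. -/
def Witness (n : ℕ) (q p : Baire) : Prop :=
  (∀ j < n.unpair.1.unpair.2 + 1, prefixCode n.unpair.1.unpair.1 p j < n) ∧
  (∀ j < n.unpair.1.unpair.2, q (prefixCode n.unpair.1.unpair.1 p j) = 0) ∧
  2 ≤ q (prefixCode n.unpair.1.unpair.1 p n.unpair.1.unpair.2)

theorem unpair_unpair_le (n : ℕ) : n.unpair.1.unpair.2 ≤ n :=
  (Nat.unpair_right_le _).trans (Nat.unpair_left_le _)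

theorem Witness.congr {n : ℕ} {q q' p p' : Baire} (hq : ∀ i < n, q i = q' i)
    (hp : ∀ i < n, p i = p' i) (h : Witness n q p) : Witness n q' p' := by
  obtain ⟨h1, h2, h3⟩ := h
  have hle := unpair_unpair_le n
  have hc : ∀ j < n.unpair.1.unpair.2 + 1, prefixCode n.unpair.1.unpair.1 p' j =
      prefixCode n.unpair.1.unpair.1 p j := fun j hj =>
    prefixCode_congr _ fun i hi => (hp i (by omega)).symm
  refine ⟨fun j hj => ?_, fun j hj => ?_, ?_⟩
  · rw [hc j hj]
    exact h1 j hj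
  · rw [hc j (by omega), ← hq _ (h1 j (by omega))]
    exact h2 j hj
  · rw [hc _ (by omega), ← hq _ (h1 _ (by omega))]
    exact h3

theorem witness_congr {n : ℕ} {q q' p p' : Baire} (hq : ∀ i < n, q i = q' i)
    (hp : ∀ i < n, p i = p' i) : Witness n q p ↔ Witness n q' p' :=
  ⟨Witness.congr hq hp, Witness.congr (fun i hi => (hq i hi).symm) fun i hi => (hp i hi).symm⟩

/-- Answers of an associate are shifted by one, so a nonzero value is a first nonzero answer that is
at least 2. -/
theorem exists_witness_iff {q p r : Baire} (hr : r ∈ eta q p) :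
    (∃ n, Witness n q p) ↔ ∃ n, r n ≠ 0 := by
  rw [mem_eta_iff] at hr
  constructor
  · rintro ⟨n, -, h2, h3⟩
    refine ⟨n.unpair.1.unpair.1, ?_⟩
    obtain ⟨k, hk, hj⟩ := hr n.unpair.1.unpair.1
    have : k = n.unpair.1.unpair.2 := by
      rcases lt_trichotomy k n.unpair.1.unpair.2 with h | h | h
      · have := h2 k h; omega
      · exact h
      · have := hj _ h; omega
    subst this
    omega
  · rintro ⟨i, hi⟩
    obtain ⟨k, hk, hj⟩ := hr i
    obtain ⟨N, hN⟩ : ∃ N, ∀ j < k + 1, prefixCode i p j < N :=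
      ⟨(Finset.range (k + 1)).sup (prefixCode i p) + 1, fun j hj =>
        Nat.lt_succ_of_le (Finset.le_sup (f := prefixCode i p) (Finset.mem_range.2 hj))⟩
    -- `i` is the output index and `k` the prefix length. `N` only enlarges the pair until it
    -- exceeds all codes queried.
    refine ⟨Nat.pair (Nat.pair i k) N, ?_⟩
    simp only [Witness, Nat.unpair_pair]
    exact ⟨fun j hj => (hN j hj).trans_le (Nat.right_le_pair _ _), hj, by omega⟩

theorem primrecPred_forall_lt {α : Type*} [Primcodable α] {R : ℕ → α → Prop} (hR : PrimrecRel R)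
    {k : α → ℕ} (hk : Primrec k) : PrimrecPred fun x => ∀ j < k x, R j x :=
  (hR.forall_mem_list.comp (Primrec.list_range.comp hk) Primrec.id).of_eq (by simp)

theorem primrecPred_witness {α : Type*} [Primcodable α] {n : α → ℕ} {f g : α → Baire}
    (hn : Primrec n) (hf : Primrec₂ fun x m => f x m) (hg : Primrec₂ fun x m => g x m) :
    PrimrecPred fun x => Witness (n x) (f x) (g x) := by
  have hu := Primrec.unpair.comp (Primrec.fst.comp (Primrec.unpair.comp hn))
  have hi := Primrec.fst.comp hu
  have hj := Primrec.snd.comp hu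
  have hc : Primrec fun y : ℕ × α => prefixCode (n y.2).unpair.1.unpair.1 (g y.2) y.1 :=
    primrec_prefixCode (hi.comp Primrec.snd)
      (hg.comp (Primrec.snd.comp Primrec.fst) Primrec.snd) Primrec.fst
  have h1 : PrimrecRel fun (j : ℕ) (x : α) => prefixCode (n x).unpair.1.unpair.1 (g x) j < n x :=
    Primrec.nat_lt.comp hc (hn.comp Primrec.snd)
  have h2 : PrimrecRel fun (j : ℕ) (x : α) =>
      f x (prefixCode (n x).unpair.1.unpair.1 (g x) j) = 0 :=
    Primrec.eq.comp (hf.comp Primrec.snd hc) (Primrec.const 0)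
  have h1' : PrimrecPred fun x => ∀ j < (n x).unpair.1.unpair.2 + 1,
      prefixCode (n x).unpair.1.unpair.1 (g x) j < n x :=
    primrecPred_forall_lt h1 (Primrec.succ.comp hj)
  have h2' : PrimrecPred fun x => ∀ j < (n x).unpair.1.unpair.2,
      f x (prefixCode (n x).unpair.1.unpair.1 (g x) j) = 0 :=
    primrecPred_forall_lt h2 hj
  have h3 : PrimrecPred fun x =>
      2 ≤ f x (prefixCode (n x).unpair.1.unpair.1 (g x) (n x).unpair.1.unpair.2) :=
    Primrec.nat_le.comp (Primrec.const 2) (hf.comp Primrec.id (primrec_prefixCode hi hg hj))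
  exact h1'.and (h2'.and h3)

/-! ### Evaluation and pullback as computable functionals -/

open Classical in
/-- An associate of `q ↦ η_q(p)`, up to equality of names of points of Sierpiński space. -/
noncomputable def evalAssociate (p : Baire) : Baire :=
  localAssociate fun n q => if Witness n q p then 1 else 0

open Classical in
/-- An associate of `z ↦ η_s(evalAssociate z)`, up to equality of names of points of Sierpiński
space. -/
noncomputable def pullbackAssociate (s : Baire) : Baire :=
  localAssociate fun n z => if Witness n s (evalAssociate z) then 1 else 0

theorem exists_ite_ne_zero (P : ℕ → Prop) [DecidablePred P] :
    (∃ n, (if P n then 1 else 0) ≠ 0) ↔ ∃ n, P n := by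
  simp

theorem exists_mem_eta_evalAssociate {q p r : Baire} (hr : r ∈ eta q p) :
    ∃ r' ∈ eta (evalAssociate p) q, ((∃ n, r' n ≠ 0) ↔ ∃ n, r n ≠ 0) := by
  classical
  refine ⟨_, mem_eta_localAssociate ?_ q, ?_⟩
  · intro n q q' h
    simp only [witness_congr h fun i _ => rfl]
  · simp only [exists_ite_ne_zero]
    exact exists_witness_iff hr

theorem isLocal_evalAssociate : IsLocal fun c p => evalAssociate p c := by
  classical
  refine isLocal_localAssociate (T := fun n p q => if Witness n q p then 1 else 0) ?_
  intro n s s' z h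
  simp only [witness_congr (fun i _ => rfl) h]

theorem exists_mem_eta_pullbackAssociate {s z r : Baire} (hr : r ∈ eta s (evalAssociate z)) :
    ∃ r' ∈ eta (pullbackAssociate s) z, ((∃ n, r' n ≠ 0) ↔ ∃ n, r n ≠ 0) := by
  classical
  refine ⟨_, mem_eta_localAssociate ?_ z, ?_⟩
  · intro n z z' h
    -- Two local functionals compose to a local one: `n` values of `z` fix the first `n` values of
    -- `evalAssociate z`.
    have : ∀ i < n, evalAssociate z i = evalAssociate z' i := fun i hi =>
      isLocal_evalAssociate i z z' fun j hj => h j (hj.trans hi)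
    simp only [witness_congr (fun i _ => rfl) this]
  · simp only [exists_ite_ne_zero]
    exact exists_witness_iff hr

theorem isLocal_pullbackAssociate : IsLocal fun c s => pullbackAssociate s c := by
  classical
  refine isLocal_localAssociate
    (T := fun n s z => if Witness n s (evalAssociate z) then 1 else 0) ?_
  intro n s s' z h
  simp only [witness_congr h fun i _ => rfl]

theorem primrec_evalAssociate {α : Type*} [Primcodable α] {f : α → Baire}
    (hf : Primrec₂ fun x m => f x m) : Primrec₂ fun x c => evalAssociate (f x) c := by
  classical
  refine primrec_localAssociate (A := fun x n q => if Witness n q (f x) then 1 else 0) ?_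
  exact Primrec.ite (primrecPred_witness (Primrec.fst.comp Primrec.snd)
    (primrec_word (Primrec.snd.comp Primrec.snd)) (hf.comp (Primrec.fst.comp Primrec.fst)
      Primrec.snd)) (Primrec.const 1) (Primrec.const 0)

theorem primrec_pullbackAssociate {α : Type*} [Primcodable α] {f : α → Baire}
    (hf : Primrec₂ fun x m => f x m) : Primrec₂ fun x c => pullbackAssociate (f x) c := by
  classical
  refine primrec_localAssociate
    (A := fun x n z => if Witness n (f x) (evalAssociate z) then 1 else 0) ?_
  exact Primrec.ite (primrecPred_witness (Primrec.fst.comp Primrec.snd)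
    (hf.comp (Primrec.fst.comp Primrec.fst) Primrec.snd)
    (primrec_evalAssociate (primrec_word (Primrec.snd.comp Primrec.snd))))
    (Primrec.const 1) (Primrec.const 0)

/-- A function on Baire space given by a primitive recursive local family is computable. -/
theorem isComputable_of_isLocal {Φ : Baire → Baire} (hΦ : IsLocal fun c p => Φ p c)
    (hp : Primrec₂ fun (l : List ℕ) c => Φ (word l) c) : IsComputable (Φ : Baire →. Baire) := by
  refine ⟨localAssociate fun c p => Φ p c, ?_, fun p r hr => ?_⟩
  · have := primrec_localAssociate (α := Unit) (A := fun _ c p => Φ p c)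
      (hp.comp (Primrec.snd.comp Primrec.snd) (Primrec.fst.comp Primrec.snd))
    exact (this.comp (Primrec.const ()) Primrec.id).to_comp
  · obtain rfl : r = Φ p := by simpa using hr
    exact mem_eta_localAssociate hΦ p

theorem isComputable_evalAssociate : IsComputable (evalAssociate : Baire →. Baire) :=
  isComputable_of_isLocal isLocal_evalAssociate (primrec_evalAssociate (primrec_word Primrec.id))

theorem isComputable_pullbackAssociate : IsComputable (pullbackAssociate : Baire →. Baire) :=
  isComputable_of_isLocal isLocal_pullbackAssociate
    (primrec_pullbackAssociate (primrec_word Primrec.id))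


/-! ### Open sets and prefixes of names -/

theorem isOpen_cylinder (p : Baire) (N : ℕ) : IsOpen {p' : Baire | ∀ i < N, p' i = p i} := by
  have : IsOpen (⋂ i ∈ Set.Iio N, {p' : Baire | p' i = p i}) :=
    (Set.finite_Iio N).isOpen_biInter fun i _ =>
      (isOpen_discrete {p i}).preimage (continuous_apply (A := fun _ : ℕ => ℕ) i)
  convert this using 1
  ext
  simp

theorem exists_cylinder_subset {V : Set Baire} (hV : IsOpen V) {p : Baire} (hp : p ∈ V) :
    ∃ N, ∀ p' : Baire, (∀ i < N, p' i = p i) → p' ∈ V := by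
  have hnhds := hV.mem_nhds hp
  rw [nhds_pi, Filter.mem_pi] at hnhds
  obtain ⟨I, hI, t, ht, hsub⟩ := hnhds
  obtain ⟨n, hn⟩ := hI.bddAbove
  refine ⟨n + 1, fun s hs => hsub fun i hi => ?_⟩
  rw [hs i (Nat.lt_succ_of_le (hn hi))]
  exact mem_of_mem_nhds (ht i)

/-- Cylinders form a base of Baire space; in the subspace topology only sequences in the domain of
`δ` count. -/
theorem isOpen_preimage_asSubtype_iff {X : Type u} (δ : Baire →. X) (U : Set X) :
    IsOpen (δ.asSubtype ⁻¹' U) ↔ ∀ p, ∀ x ∈ δ p, x ∈ U →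
      ∃ N, ∀ p', ∀ x' ∈ δ p', (∀ i < N, p' i = p i) → x' ∈ U := by
  constructor
  · intro h p x hx hxU
    obtain ⟨V, hVo, hV⟩ := isOpen_induced_iff.1 h
    have key : ∀ p x, x ∈ δ p → (p ∈ V ↔ x ∈ U) := by
      rintro p x ⟨hd, rfl⟩
      exact Set.ext_iff.1 hV ⟨p, hd⟩
    obtain ⟨N, hN⟩ := exists_cylinder_subset hVo ((key p x hx).2 hxU)
    exact ⟨N, fun p' x' hx' h' => (key p' x' hx').1 (hN p' h')⟩
  · intro h
    rw [isOpen_iff_mem_nhds]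
    rintro ⟨p, hd⟩ hp
    obtain ⟨N, hN⟩ := h p _ ⟨hd, rfl⟩ hp
    have ho := (isOpen_cylinder p N).preimage (continuous_subtype_val (p := (· ∈ δ.Dom)))
    refine Filter.mem_of_superset (ho.mem_nhds (fun i _ => rfl)) ?_
    rintro ⟨p', hd'⟩ h'
    exact hN p' _ ⟨hd', rfl⟩ h'

theorem Representation.isOpen_finalTopology_iff {X : Type u} (δ : Representation X) (U : Set X) :
    IsOpen[δ.finalTopology] U ↔ ∀ p, ∀ x ∈ δ.toPFun p, x ∈ U →
      ∃ N, ∀ p', ∀ x' ∈ δ.toPFun p', (∀ i < N, p' i = p i) → x' ∈ U := by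
  rw [Representation.finalTopology, isOpen_coinduced]
  exact isOpen_preimage_asSubtype_iff δ.toPFun U

theorem continuous_asSubtype_of_isLocal {Φ : Baire → Baire} (hΦ : IsLocal fun c p => Φ p c) :
    Continuous (Φ : Baire →. Baire).asSubtype := by
  have hc : Continuous Φ := by
    refine continuous_pi fun c => continuous_def.2 fun S _ => ?_
    rw [isOpen_iff_mem_nhds]
    intro p hp
    refine Filter.mem_of_superset ((isOpen_cylinder p c).mem_nhds fun i _ => rfl) ?_
    intro p' hp'
    have h : Φ p' c = Φ p c := hΦ c p' p hp'
    rwa [Set.mem_preimage, h]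
  exact hc.comp continuous_subtype_val

theorem openName_of_exists {X : Type u} {δ : Representation X} {q : Baire} {U : OpenSets δ}
    (h : ∀ p, ∀ x ∈ δ.toPFun p, ∃ r ∈ eta q p, ((∃ n, r n ≠ 0) ↔ x ∈ U.1)) : OpenName δ q U := by
  intro p x y hx hy
  obtain rfl : y = (x ∈ U.1) := by simpa using hy
  obtain ⟨r, hr, hr'⟩ := h p x hx
  exact ⟨r, hr, by simpa [sierpinskiRep] using hr'.symm⟩

/-- Membership of a point in an open set is semidecided from finite prefixes of the names. -/
theorem OpenName.exists_prefix {Y : Type v} {δY : Representation Y} {q z : Baire} {U : OpenSets δY}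
    {y : Y} (hq : OpenName δY q U) (hz : y ∈ δY.toPFun z) (hy : y ∈ U.1) :
    ∃ N, ∀ q' U' z' y', OpenName δY q' U' → y' ∈ δY.toPFun z' → (∀ i < N, q' i = q i) →
      (∀ i < N, z' i = z i) → y' ∈ U'.1 := by
  obtain ⟨r, hr, hiff⟩ := hq.exists_iff hz
  -- The witness is its own modulus: `Witness N` inspects only `N` values of each sequence.
  obtain ⟨N, hN⟩ := (exists_witness_iff hr).2 (hiff.1 hy)
  refine ⟨N, fun q' U' z' y' hq' hz' h1 h2 => ?_⟩
  obtain ⟨r', hr', hiff'⟩ := hq'.exists_iff hz'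
  exact hiff'.2 ((exists_witness_iff hr').1
    ⟨N, hN.congr (fun i hi => (h1 i hi).symm) fun i hi => (h2 i hi).symm⟩)

theorem eq_of_mem_partialInverse {X : Type u} {Y : Type v} {f : X → Y} {x : X} {y : Y}
    (h : x ∈ partialInverse f y) : f x = y := by
  obtain ⟨hd, rfl⟩ := h
  exact Exists.choose_spec hd

/-- A name of `x` is kept as the fixed argument at which names of open sets are evaluated; no
property of `δ` is needed. -/
theorem computableRepMap_neighbourhoodMap {X : Type u} (δ : Representation X) :
    ComputableRepMap δ (openRep (openRep δ)) (neighbourhoodMap δ : X →. OpenSets (openRep δ)) := by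
  refine ⟨_, isComputable_evalAssociate, fun p x y hx hy => ?_⟩
  obtain rfl : y = neighbourhoodMap δ x := by simpa using hy
  refine ⟨evalAssociate p, by simp, ?_⟩
  rw [mem_openRep]
  refine openName_of_exists fun q U hU => ?_
  rw [mem_openRep] at hU
  obtain ⟨r, hr, hiff⟩ := hU.exists_iff hx
  obtain ⟨r', hr', hiff'⟩ := exists_mem_eta_evalAssociate hr
  exact ⟨r', hr', hiff'.trans hiff.symm⟩

/-! ### The Kolmogorov property of the presubbase representation -/

section Presubbase

variable {X : Type u} {Y : Type v} {δY : Representation Y} {B : Y → Set X}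

theorem mem_presubbaseRep_iff_openName (hB : IsPresubbase δY B) (p : Baire) (x : X) :
    x ∈ (presubbaseRep hB).toPFun p ↔ OpenName δY p (transpose hB x) := by
  rw [mem_presubbaseRep, mem_openRep]

theorem isOpen_presubbase (hB : IsPresubbase δY B) (y : Y) :
    IsOpen[(presubbaseRep hB).finalTopology] (B y) := by
  obtain ⟨z, hz⟩ := δY.surj y
  rw [Representation.isOpen_finalTopology_iff]
  intro p x hx hxy
  rw [mem_presubbaseRep_iff_openName] at hx
  obtain ⟨N, hN⟩ := hx.exists_prefix hz hxy
  refine ⟨N, fun p' x' hx' h => ?_⟩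
  rw [mem_presubbaseRep_iff_openName] at hx'
  exact hN p' _ z y hx' hz h fun _ _ => rfl

/-- From a name of the index `y`, one computes a name of the open set `B y`. -/
theorem openName_presubbase (hB : IsPresubbase δY B) {z : Baire} {y : Y} (hz : y ∈ δY.toPFun z) :
    OpenName (presubbaseRep hB) (evalAssociate z) ⟨B y, isOpen_presubbase hB y⟩ := by
  refine openName_of_exists fun p x hx => ?_
  -- The name `p` is itself an associate, so it can be evaluated at `z`.
  rw [mem_presubbaseRep_iff_openName] at hx
  obtain ⟨r, hr, hiff⟩ := hx.exists_iff hz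
  obtain ⟨r', hr', hiff'⟩ := exists_mem_eta_evalAssociate hr
  exact ⟨r', hr', hiff'.trans hiff.symm⟩

theorem injective_neighbourhoodMap_presubbaseRep (hB : IsPresubbase δY B) :
    Function.Injective (neighbourhoodMap (presubbaseRep hB)) := by
  intro x x' h
  refine hB.injective (Set.ext fun y => ?_)
  have h' := congrArg Subtype.val h
  exact Set.ext_iff.1 h' ⟨B y, isOpen_presubbase hB y⟩

/-- The set `{y | x ∈ B y}` is the preimage of `{U | x ∈ U}` under `y ↦ B y`, so a name of it arises
by composing `s` with `evalAssociate`. -/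
theorem computableRepMap_partialInverse_neighbourhoodMap (hB : IsPresubbase δY B) :
    ComputableRepMap (openRep (openRep (presubbaseRep hB))) (presubbaseRep hB)
      (partialInverse (neighbourhoodMap (presubbaseRep hB))) := by
  refine ⟨_, isComputable_pullbackAssociate, fun s W x hs hx => ?_⟩
  obtain rfl := eq_of_mem_partialInverse hx
  refine ⟨pullbackAssociate s, by simp, ?_⟩
  rw [mem_presubbaseRep_iff_openName]
  refine openName_of_exists fun z y hz => ?_
  rw [mem_openRep] at hs
  obtain ⟨r, hr, hiff⟩ := hs.exists_iff ((mem_openRep _ _ _).2 (openName_presubbase hB hz))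
  obtain ⟨r', hr', hiff'⟩ := exists_mem_eta_pullbackAssociate hr
  exact ⟨r', hr', hiff'.trans hiff.symm⟩

theorem isComputableKolmogorov_presubbaseRep (hB : IsPresubbase δY B) :
    (presubbaseRep hB).IsComputableKolmogorov :=
  ⟨injective_neighbourhoodMap_presubbaseRep hB, computableRepMap_neighbourhoodMap _,
    computableRepMap_partialInverse_neighbourhoodMap hB⟩

/-! ### The generated topology and admissibility -/

theorem isTopologicalBasis_compactIntersections (δY : Representation Y) (B : Y → Set X) :
    @TopologicalSpace.IsTopologicalBasis X (compactIntersectionTopology δY B)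
      (compactIntersections δY B) := by
  let _ := compactIntersectionTopology δY B
  refine ⟨?_, ?_, rfl⟩
  · have hinter : ∀ s ∈ compactIntersections δY B, ∀ t ∈ compactIntersections δY B,
        s ∩ t ∈ compactIntersections δY B := by
      rintro s (rfl | ⟨K, hK, rfl⟩) t (rfl | ⟨L, hL, rfl⟩)
      · left
        simp
      · rw [Set.univ_inter]
        exact Or.inr ⟨L, hL, rfl⟩
      · rw [Set.inter_univ]
        exact Or.inr ⟨K, hK, rfl⟩
      · refine Or.inr ⟨K ∪ L, @IsCompact.union _ δY.finalTopology _ _ hK hL, ?_⟩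
        rw [Set.biInter_union]
    exact fun s hs t ht x hx => ⟨s ∩ t, hinter s hs t ht, hx, subset_rfl⟩
  · exact Set.sUnion_eq_univ_iff.2 fun x => ⟨Set.univ, Or.inl rfl, trivial⟩

theorem continuousWrt_presubbaseRep (hB : IsPresubbase δY B) :
    (presubbaseRep hB).ContinuousWrt (compactIntersectionTopology δY B) := by
  refine continuous_generateFrom_iff.2 ?_
  rintro A (rfl | ⟨K, hK, rfl⟩)
  · exact isOpen_univ
  rw [isOpen_preimage_asSubtype_iff]
  intro p x hx hxK
  rw [mem_presubbaseRep_iff_openName] at hx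
  by_contra! hcon
  choose P ξ hP hPp hξ using hcon
  simp only [mem_presubbaseRep_iff_openName] at hP
  let _ := δY.finalTopology
  -- An increasing open cover of `K`: one `V n` containing `K` would put `ξ n` into the
  -- intersection.
  let V : ℕ → Set Y := fun n => {y | x ∈ B y ∧ ∀ m ≥ n, ξ m ∈ B y}
  have hVo : ∀ n, IsOpen (V n) := by
    intro n
    rw [Representation.isOpen_finalTopology_iff]
    rintro z y hz ⟨hy, hyn⟩
    obtain ⟨N, hN⟩ := hx.exists_prefix hz hy
    have hM : ∀ m, ∃ M, n ≤ m → ∀ z', ∀ y' ∈ δY.toPFun z', (∀ i < M, z' i = z i) →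
        ξ m ∈ B y' := by
      intro m
      by_cases hm : n ≤ m
      · obtain ⟨M, hM⟩ := (hP m).exists_prefix hz (hyn m hm)
        exact ⟨M, fun _ z' y' hz' h => hM _ _ z' y' (hP m) hz' (fun _ _ => rfl) h⟩
      · exact ⟨0, fun h => absurd h hm⟩
    choose M hM using hM
    -- For `m ≥ N` the name `P m` agrees with `p` on the decisive prefix, so `N` works for all such
    -- `m` at once. Only the finitely many `m < N` need their own moduli.
    refine ⟨max N ((Finset.range N).sup M), fun z' y' hz' h => ⟨?_, fun m hm => ?_⟩⟩
    · exact hN p _ z' y' hx hz' (fun _ _ => rfl) fun i hi => h i (lt_max_of_lt_left hi)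
    · rcases lt_or_ge m N with hmN | hmN
      · exact hM m hm z' y' hz' fun i hi => h i (lt_max_of_lt_right
          (hi.trans_le (Finset.le_sup (Finset.mem_range.2 hmN))))
      · exact hN _ _ z' y' (hP m) hz' (fun i hi => hPp m i (hi.trans_le hmN))
          fun i hi => h i (lt_max_of_lt_left hi)
  have hcover : K ⊆ ⋃ n, V n := by
    intro y hy
    have hxy : x ∈ B y := Set.mem_iInter₂.1 hxK y hy
    obtain ⟨z, hz⟩ := δY.surj y
    obtain ⟨N, hN⟩ := hx.exists_prefix hz hxy
    exact Set.mem_iUnion.2 ⟨N, hxy, fun m hm => hN _ _ z y (hP m) hz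
      (fun i hi => hPp m i (hi.trans_le hm)) fun _ _ => rfl⟩
  have hmono : Monotone V := fun a b hab y hy => ⟨hy.1, fun m hm => hy.2 m (hab.trans hm)⟩
  obtain ⟨n, hn⟩ := hK.elim_directed_cover V hVo hcover hmono.directed_le
  exact hξ n (Set.mem_iInter₂.2 fun y hy => (hn hy).2 n le_rfl)

/-- If `δ` is continuous for the topology generated by the compact intersections, then membership in
the sets `B y` is semidecided from finite prefixes of the names of the point and of the index. -/
theorem exists_prefix_of_continuousWrt (hB : IsPresubbase δY B) {δ : Representation X}
    (hδ : δ.ContinuousWrt (compactIntersectionTopology δY B)) {p z : Baire} {x : X} {y : Y}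
    (hx : x ∈ δ.toPFun p) (hz : y ∈ δY.toPFun z) (hxy : x ∈ B y) :
    ∃ N, ∀ p' x' z' y', x' ∈ δ.toPFun p' → y' ∈ δY.toPFun z' → (∀ i < N, p' i = p i) →
      (∀ i < N, z' i = z i) → x' ∈ B y' := by
  by_contra! hcon
  choose P ξ Z υ hξ hυ hP hZ hnot using hcon
  let _ := δY.finalTopology
  have hev : ∀ S : Set Y, IsOpen S → y ∈ S → ∃ N, ∀ n ≥ N, υ n ∈ S := by
    intro S hS hyS
    obtain ⟨N, hN⟩ := (δY.isOpen_finalTopology_iff S).1 hS z y hz hyS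
    exact ⟨N, fun n hn => hN _ _ (hυ n) fun i hi => hZ n i (hi.trans_le hn)⟩
  -- The first `N` indices are dropped, so that `x ∈ B y'` holds for every index `y'` that remains.
  obtain ⟨N, hN⟩ := hev _ (hB.isOpen x) hxy
  have hlim : Filter.Tendsto (fun n => υ (n + N)) Filter.atTop (𝓝 y) := by
    refine tendsto_nhds.2 fun S hS hyS => ?_
    obtain ⟨M, hM⟩ := hev S hS hyS
    exact Filter.mem_atTop_sets.2 ⟨M, fun n hn => hM _ (by omega)⟩
  have hKo : IsOpen[compactIntersectionTopology δY B]
      (⋂ y' ∈ insert y (Set.range fun n => υ (n + N)), B y') :=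
    TopologicalSpace.isOpen_generateFrom_of_mem (Or.inr ⟨_, hlim.isCompact_insert_range, rfl⟩)
  have hxK : x ∈ ⋂ y' ∈ insert y (Set.range fun n => υ (n + N)), B y' := by
    refine Set.mem_iInter₂.2 ?_
    rintro y' (rfl | ⟨n, rfl⟩)
    · exact hxy
    · exact hN _ (by omega)
  obtain ⟨M, hM⟩ := (isOpen_preimage_asSubtype_iff δ.toPFun _).1
    (@IsOpen.preimage _ _ _ (compactIntersectionTopology δY B) _ hδ _ hKo) p x hx hxK
  -- The index `M + N` is late enough both for the name to lie in the cylinder around `p` and for `υ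
  -- (M + N)` to belong to the compact set.
  have := hM _ _ (hξ (M + N)) fun i hi => hP _ i (by omega)
  exact hnot (M + N) (Set.mem_iInter₂.1 this (υ (M + N)) (Or.inr ⟨M, rfl⟩))

theorem isAdmissible_presubbaseRep (hB : IsPresubbase δY B) :
    (presubbaseRep hB).IsAdmissible (compactIntersectionTopology δY B) := by
  classical
  refine ⟨continuousWrt_presubbaseRep hB, fun δ hδ => ?_⟩
  -- The prefixes of length `n` already force membership. `R` need not be decidable, so the
  -- resulting translation is only continuous.
  let R : ℕ → Baire → Baire → Prop := fun n p z =>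
    ∀ p' x' z' y', x' ∈ δ.toPFun p' → y' ∈ δY.toPFun z' → (∀ i < n, p' i = p i) →
      (∀ i < n, z' i = z i) → x' ∈ B y'
  have hR : ∀ n p q z w, (∀ i < n, p i = q i) → (∀ i < n, z i = w i) → R n p z → R n q w :=
    fun n p q z w hpq hzw h p' x' z' y' hx' hy' h1 h2 => h p' x' z' y' hx' hy'
      (fun i hi => (h1 i hi).trans (hpq i hi).symm) fun i hi => (h2 i hi).trans (hzw i hi).symm
  have hR' : ∀ n p q z w, (∀ i < n, p i = q i) → (∀ i < n, z i = w i) → (R n p z ↔ R n q w) :=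
    fun n p q z w hpq hzw => ⟨hR n p q z w hpq hzw,
      hR n q p w z (fun i hi => (hpq i hi).symm) fun i hi => (hzw i hi).symm⟩
  let Φ : Baire → Baire := fun p => localAssociate fun n z => if R n p z then 1 else 0
  have hΦ : IsLocal fun c p => Φ p c := by
    refine isLocal_localAssociate (T := fun n p z => if R n p z then 1 else 0) ?_
    intro n s s' z h
    simp only [hR' n s s' z z h fun _ _ => rfl]
  refine ⟨Φ, continuous_asSubtype_of_isLocal hΦ, fun p p₀ x hp hx => ?_⟩
  obtain rfl : p₀ = p := by simpa [baireRep] using hp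
  refine ⟨Φ p₀, by simp, ?_⟩
  rw [mem_presubbaseRep_iff_openName]
  refine openName_of_exists fun z y hz => ⟨_, mem_eta_localAssociate ?_ z, ?_⟩
  · intro n w w' h
    simp only [hR' n p₀ p₀ w w' (fun _ _ => rfl) h]
  · simp only [exists_ite_ne_zero]
    -- Soundness applies the forcing condition to the names `p₀` and `z` themselves; completeness is
    -- where continuity of `δ` enters.
    exact ⟨fun ⟨n, hn⟩ => hn p₀ x z y hx hz (fun _ _ => rfl) fun _ _ => rfl,
      fun hxy => exists_prefix_of_continuousWrt hB hδ hx hz hxy⟩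

end Presubbase

end CompAn

theorem theorem7 {X : Type*} {Y : Type*} (δY : CompAn.Representation Y) (B : Y → Set X)
    (hB : CompAn.IsPresubbase δY B) :
    (CompAn.presubbaseRep hB).IsComputableKolmogorov ∧
    @TopologicalSpace.IsTopologicalBasis X (CompAn.compactIntersectionTopology δY B)
      (CompAn.compactIntersections δY B) ∧
    (CompAn.presubbaseRep hB).IsAdmissible (CompAn.compactIntersectionTopology δY B) := by
  exact ⟨CompAn.isComputableKolmogorov_presubbaseRep hB,
    CompAn.isTopologicalBasis_compactIntersections δY B, CompAn.isAdmissible_presubbaseRep hB⟩
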